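/- Let $n\ge 1$ be an integer and let $X_1,\dots,X_n$ be binary (i.e. $\{0,1\}$-valued) random variables on a common probability space that are *1-negatively correlated*, that is, for all $I\subseteq\{1,\dots,n\}$, $$\Pr[\forall i\in I: X_i=1]\le\prod_{i\in I}\Pr[X_i=1].$$ Let $a_1,\dots,a_n,b_1,\dots,b_n\in\mathbb R$ with $a_i\le b_i$ for all $i$. Let $Y_i$ be the random variable that equals $a_i$ when $X_i=0$ and $b_i$ when $X_i=1$. Let $Y=\sum_{i=1}^n Y_i$ and $\sigma^2:=\sum_{i=1}^n \mathrm{Var}[Y_i]$. Let $\mu$ be $E[Y]$ or any real number with $\mu\ge E[Y]$. Throughout, $0^0:=1$. Where a parameter is zero and an expression is thereby undefined, it is read as its limit, as specified below. **(a)** Assume that $a_i,b_i\in[0,1]$ for all $i$. Then the following hold. 1. (Multiplicative bounds.) For all $\delta\ge 0$, $\Pr[Y\ge(1+\delta)\mu]$ is at most each of $$\Big(\tfrac1{1+\delta}\Big)^{(1+\delta)\mu}\Big(\tfrac{n-\mu}{n-(1+\delta)\mu}\Big)^{n-(1+\delta)\mu},\quad \Big(\tfrac{e^\delta}{(1+\delta)^{1+\delta}}\Big)^{\mu}=\exp\big(-((1+\delta)\ln(1+\delta)-\delta)\mu\big),$$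 $$\exp\Big(-\tfrac{\delta^2\mu}{2+\frac23\delta}\Big),\quad \exp\Big(-\tfrac{\min\{\delta^2,\delta\}\mu}{3}\Big),\quad \Big(\tfrac{e}{1+\delta}\Big)^{(1+\delta)\mu},\quad \Big(\tfrac e\delta\Big)^{\delta\mu},$$ and, if $\delta\le1$, at most $\exp(-\delta^2\mu/3)$. The first bound is read as $0$ if $(1+\delta)\mu>n$ and as $(\mu/n)^n$ if $(1+\delta)\mu=n$; the bound $(e/\delta)^{\delta\mu}$ is read as $1$ if $\delta=0$. Moreover, $\Pr[Y\ge k]\le2^{-k}$ for all real $k\ge 2e\mu$. 2. (Additive bounds.) For all $\lambda\ge0$, $\Pr[Y\ge\mu+\lambda]$ is at most each of $$\exp\Big(-\tfrac{2\lambda^2}{n}\Big),\quad \Big(\tfrac{\mu}{\mu+\lambda}\Big)^{\mu+\lambda}\Big(\tfrac{n-\mu}{n-\mu-\lambda}\Big)^{n-\mu-\lambda},\quad e^\lambda\Big(\tfrac{\mu}{\mu+\lambda}\Big)^{\mu+\lambda}=\exp\Big(-(\mu+\lambda)\ln\big(1+\tfrac\lambda\mu\big)+\lambda\Big),$$ $$\exp\Big(-\tfrac{\lambda^2}{2\mu+\frac23\lambda}\Big),\quad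 \exp\Big(-\tfrac13\min\Big\{\tfrac{\lambda^2}{\mu},\lambda\Big\}\Big),$$ and, if $\lambda\le\mu$, at most $\exp(-\lambda^2/(3\mu))$. The second bound is read as $0$ if $\lambda>n-\mu$ and as $(\mu/n)^n$ if $\lambda=n-\mu$. 3. (Variance bounds.) For all $\lambda\ge0$, $\Pr[Y\ge\mu+\lambda]$ is at most each of the bounds $B_1(\lambda),B_2(\lambda),B_3(\lambda),B_4(\lambda)$ given in (b2) with $b=1$; here $B_2(\lambda)=\exp\big(-\sigma^2\big((1+\tfrac{\lambda}{\sigma^2})\ln(1+\tfrac{\lambda}{\sigma^2})-\tfrac{\lambda}{\sigma^2}\big)\big)$. In multiplicative form, for all $\delta\ge0$, $\Pr[Y\ge(1+\delta)\mu]$ is at most $B_1(\delta\mu)$ and at most $B_3(\delta\mu)=\exp\big(-\frac{\delta^2\mu^2}{2\sigma^2+\frac23\delta\mu}\big)$. **(b)** For arbitrary real $a_i\le b_i$ the following hold. 1. For all $\lambda>0$, with $c_i:=b_i-a_i$, $\displaystyle \Pr[Y\ge\mu+\lambda]\le\exp\Big(-\frac{2\lambda^2}{\sum_{i=1}^n c_i^2}\Big)$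 (read as $0$ if all $c_i=0$). 2. Let $b>0$ be such that $Y_i\le E[Y_i]+b$ almost surely for all $i$. Then for all $\lambda\ge0$, $\Pr[Y\ge\mu+\lambda]$ is at most each of $$B_1(\lambda)=\bigg(\Big(1+\tfrac{b\lambda}{\sigma^2}\Big)^{-(1+\frac{b\lambda}{\sigma^2})\frac{\sigma^2}{nb^2+\sigma^2}}\Big(1-\tfrac{\lambda}{nb}\Big)^{-(1-\frac{\lambda}{nb})\frac{nb^2}{nb^2+\sigma^2}}\bigg)^n,$$ $$B_2(\lambda)=\exp\Big(-\tfrac\lambda b\Big(\big(1+\tfrac{\sigma^2}{b\lambda}\big)\ln\big(1+\tfrac{b\lambda}{\sigma^2}\big)-1\Big)\Big),$$ $$B_3(\lambda)=\exp\Big(-\tfrac{\lambda^2}{\sigma^2\left(2+\frac23\frac{b\lambda}{\sigma^2}\right)}\Big),\qquad B_4(\lambda)=\exp\Big(-\tfrac13\min\Big\{\tfrac{\lambda^2}{\sigma^2},\tfrac\lambda b\Big\}\Big),$$ where $B_1(\lambda)$ is read as $0$ if $\lambda>nb$ and as $\big(\frac{\sigma^2}{nb^2+\sigma^2}\big)^n$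 if $\lambda=nb$. Conventions for zero parameters: all bounds other than $\Pr[Y \ge k] \le 2^{-k}$ are read as $1$ if $\lambda=0$ (or $\delta\mu=0$ in multiplicative form), unless a reading given above applies. For $\lambda>0$ and $\mu=0$, $\exp(-(\mu+\lambda)\ln(1+\lambda/\mu)+\lambda)$ is read as $0$ and $\min\{\lambda^2/\mu,\lambda\}$ as $\lambda$. For $\lambda>0$ and $\sigma^2=0$, $B_1(\lambda)$ (if $\lambda<nb$) and $B_2(\lambda)$ are read as $0$, $B_3(\lambda)$ as $\exp(-3\lambda/(2b))$, and $\min\{\lambda^2/\sigma^2,\lambda/b\}$ as $\lambda/b$. -/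

import Mathlib

open MeasureTheory ProbabilityTheory

noncomputable section

/-- Binary random variables on a common probability space: measurable functions that take
only the values `0` and `1` (almost surely). -/
def IsBinaryFamily {Ω : Type*} [MeasurableSpace Ω] (P : Measure Ω) {n : ℕ}
    (X : Fin n → Ω → ℝ) : Prop :=
  ∀ i, Measurable (X i) ∧ ∀ᵐ ω ∂P, X i ω = 0 ∨ X i ω = 1

/-- `1`-negative correlation: for every index set `I`, the event that all `X i` with `i ∈ I`
equal `1` is at most as likely as in the independent case. -/
def OneNegativelyCorrelated {Ω : Type*} [MeasurableSpace Ω] (P : Measure Ω) {n : ℕ}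
    (X : Fin n → Ω → ℝ) : Prop :=
  ∀ I : Finset (Fin n),
    P.real {ω | ∀ i ∈ I, X i ω = 1} ≤ ∏ i ∈ I, P.real {ω | X i ω = 1}

/-- The strongest multiplicative bound
`(1/(1+δ))^((1+δ)m) * ((n-m)/(n-(1+δ)m))^(n-(1+δ)m)`,
read as `0` when `(1+δ)m > n` and as `(m/n)^n` when `(1+δ)m = n`. -/
def chernoffMult (n : ℕ) (m δ : ℝ) : ℝ :=
  if (n : ℝ) < (1 + δ) * m then 0
  else if (1 + δ) * m = n then (m / n) ^ n
  else (1 / (1 + δ)) ^ ((1 + δ) * m) *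
    ((n - m) / (n - (1 + δ) * m)) ^ (n - (1 + δ) * m)

/-- The strongest multiplicative bound in additive form,
`(m/(m+l))^(m+l) * ((n-m)/(n-m-l))^(n-m-l)`,
read as `0` when `l > n - m` and as `(m/n)^n` when `l = n - m`. -/
def chernoffAdd (n : ℕ) (m l : ℝ) : ℝ :=
  if (n : ℝ) - m < l then 0
  else if l = n - m then (m / n) ^ n
  else (m / (m + l)) ^ (m + l) * ((n - m) / (n - m - l)) ^ (n - m - l)

/-- `exp(-(m+l) ln(1+l/m) + l)`; for `m = 0` this is the limit `m → 0+`, that is,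
`1` if `l = 0` and `0` if `l > 0`. -/
def chernoffAddExp (m l : ℝ) : ℝ :=
  if m = 0 then (if l = 0 then 1 else 0)
  else Real.exp (-((m + l) * Real.log (1 + l / m)) + l)

/-- `min {l²/v, u}`, where `l²/v` counts as `+∞` when `v = 0`. -/
def minSqDiv (l v u : ℝ) : ℝ :=
  if v = 0 then u else min (l ^ 2 / v) u

/-- `exp(-2l²/C)` for `l > 0`, which is `0` (the limit) when `C = 0`. -/
def hoeffdingBound (C l : ℝ) : ℝ :=
  if C = 0 then 0 else Real.exp (-(2 * l ^ 2 / C))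

/-- The strongest variance bound, for variance parameter `s` (that is, `σ²`) and deviations
of the single variables at most `b`:
`((1+bl/s)^(-(1+bl/s) s/(nb²+s)) * (1-l/(nb))^(-(1-l/(nb)) nb²/(nb²+s)))^n`,
read as `0` when `l > nb` and as `(s/(nb²+s))^n` when `l = nb`.
For `s = 0` and `l < nb` this is the limit `s → 0+`, that is, `1` if `l = 0`, `0` if `l > 0`. -/
def varianceStrongest (n : ℕ) (b s l : ℝ) : ℝ :=
  if n * b < l then 0
  else if l = n * b then (s / (n * b ^ 2 + s)) ^ n
  else if s = 0 then (if l = 0 then 1 else 0)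
  else ((1 + b * l / s) ^ (-((1 + b * l / s) * (s / (n * b ^ 2 + s)))) *
      (1 - l / (n * b)) ^ (-((1 - l / (n * b)) * (n * b ^ 2 / (n * b ^ 2 + s))))) ^ n

/-- Bennett's bound `exp(-(l/b) ((1+s/(bl)) ln(1+bl/s) - 1))`; for `s = 0` or `l = 0` this is
the respective limit. -/
def bennettBound (b s l : ℝ) : ℝ :=
  if l = 0 then 1
  else if s = 0 then 0
  else Real.exp (-(l / b * ((1 + s / (b * l)) * Real.log (1 + b * l / s) - 1)))

/-- The second form of Bennett's bound for `b = 1`,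
`exp(-s ((1+l/s) ln(1+l/s) - l/s))`; for `s = 0` this is the limit. -/
def bennettBound' (s l : ℝ) : ℝ :=
  if s = 0 then (if l = 0 then 1 else 0)
  else Real.exp (-(s * ((1 + l / s) * Real.log (1 + l / s) - l / s)))

/-- Bernstein's bound `exp(-l²/(s (2 + (2/3) bl/s)))`; for `s = 0` this is the limit
`exp(-3l/(2b))`. -/
def bernsteinBound (b s l : ℝ) : ℝ :=
  if s = 0 then Real.exp (-(3 * l / (2 * b)))
  else Real.exp (-(l ^ 2 / (s * (2 + 2 / 3 * (b * l / s)))))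

end

/-! The tail bounds follow from the exponential moment method, and 1-negative correlation suffices
because it gives the same moment bound as independence. For `t ≥ 0` each `exp (t * Y i)` is a
nonnegative constant plus a nonnegative multiple of the indicator of `X i = 1`. Expanding the
product over subsets `I` leaves nonnegative coefficients times indicators of "all `X i = 1`, `i ∈
I`", and the hypothesis bounds each term (`integral_prod_comp_le`,
`tail_le_of_oneNegativelyCorrelated`).

What remains is deterministic: bound a product of two-point moment generating functions and optimise
over `t`. The factors are estimated in three ways. Hoeffding's lemma gives the range bound. For
values in `[0,1]`, the chord of `exp` and AM-GM compare with a binomial or Poisson law of mean at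
least `E[S]`. For deviations at most `β`, a quadratic majorant of `exp` gives Bennett's extremal law
on `{-v, 1}`; log-concavity in `v` (`concaveOn_log_bennettMGF`) permits averaging the variances.

The binomial and Bennett cases share one optimisation (`le_of_forall_exp_mgf_le`), since Bennett's
law is an affine image of a Bernoulli law. The weaker bounds come from a centred Poisson transform,
with parameter the mean or the scaled variance, and the inequality `bernstein_le_bennett`. -/

/-! ### Quadratic majorants of `exp` and Bennett's lemma -/

theorem exp_sub_one_sub_eq_sq_mul_integral {r : ℝ} :
    Real.exp r - 1 - r = r ^ 2 * ∫ u in (0 : ℝ)..1, (1 - u) * Real.exp (r * u) := by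
  have h : ∀ u ∈ Set.uIcc (0 : ℝ) 1,
      HasDerivAt (fun u : ℝ => (r * (1 - u) + 1) * Real.exp (r * u))
        (r ^ 2 * ((1 - u) * Real.exp (r * u))) u := by
    intro u _
    have h1 : HasDerivAt (fun u : ℝ => r * (1 - u) + 1) (r * (-1)) u :=
      (((hasDerivAt_id u).const_sub 1).const_mul r).add_const 1
    have h2 : HasDerivAt (fun u : ℝ => Real.exp (r * u)) (Real.exp (r * u) * (r * 1)) u :=
      ((hasDerivAt_id u).const_mul r).exp
    refine (h1.mul h2).congr_deriv ?_
    ring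
  have hi := intervalIntegral.integral_eq_sub_of_hasDerivAt h
    (Continuous.intervalIntegrable (by fun_prop) _ _)
  rw [intervalIntegral.integral_const_mul] at hi
  rw [hi]
  simp
  ring

/-- The integral form of the Taylor remainder shows that `(exp r - 1 - r) / r ^ 2` is increasing,
also across negative `r`. -/
theorem exp_le_quadratic_of_le {r R : ℝ} (h : r ≤ R) (hR : 0 < R) :
    Real.exp r ≤ 1 + r + r ^ 2 * ((Real.exp R - 1 - R) / R ^ 2) := by
  have hK : (Real.exp R - 1 - R) / R ^ 2 = ∫ u in (0 : ℝ)..1, (1 - u) * Real.exp (R * u) := by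
    rw [exp_sub_one_sub_eq_sq_mul_integral]
    field_simp
  have hle : ∫ u in (0 : ℝ)..1, (1 - u) * Real.exp (r * u) ≤
      ∫ u in (0 : ℝ)..1, (1 - u) * Real.exp (R * u) := by
    refine intervalIntegral.integral_mono_on zero_le_one
      (Continuous.intervalIntegrable (by fun_prop) _ _)
      (Continuous.intervalIntegrable (by fun_prop) _ _) fun u hu => ?_
    have h1 : r * u ≤ R * u := mul_le_mul_of_nonneg_right h hu.1
    exact mul_le_mul_of_nonneg_left (Real.exp_le_exp.2 h1) (by linarith [hu.2])
  have h1 := exp_sub_one_sub_eq_sq_mul_integral (r := r)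
  rw [hK]
  nlinarith [mul_le_mul_of_nonneg_left hle (sq_nonneg r)]

/-- Bennett's extremal moment generating function: the centred variable that is at most `1` and
has variance `v`. -/
noncomputable def bennettMGF (T v : ℝ) : ℝ :=
  Real.exp (-(T * v)) * (1 + v * Real.exp (T * (1 + v))) / (1 + v)

theorem bennettMGF_pos {T v : ℝ} (hv : 0 ≤ v) : 0 < bennettMGF T v := by
  unfold bennettMGF
  positivity

/-- Bennett's lemma for the centred two-valued variable with values `-dp`, `d(1-p)`. -/
theorem twoPoint_mgf_le_bennettMGF {p d T : ℝ} (hp : p ∈ Set.Icc (0 : ℝ) 1) (hd : 0 ≤ d)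
    (hT : 0 ≤ T) (h : p = 0 ∨ d * (1 - p) ≤ 1) :
    (1 - p) * Real.exp (T * (-(d * p))) + p * Real.exp (T * (d * (1 - p))) ≤
      bennettMGF T (d ^ 2 * p * (1 - p)) := by
  obtain ⟨hp0, hp1⟩ := hp
  rcases h with rfl | h
  · simp [bennettMGF]
  rcases hT.eq_or_lt with rfl | hT
  · have : 0 ≤ d ^ 2 * p * (1 - p) := mul_nonneg (by positivity) (by linarith)
    have h1 : 1 + d ^ 2 * p * (1 - p) ≠ 0 := by positivity
    simp [bennettMGF, div_self h1]
  have hv : 0 ≤ d ^ 2 * p * (1 - p) := mul_nonneg (by positivity) (by linarith)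
  obtain ⟨v, hvd⟩ : ∃ v, v = d ^ 2 * p * (1 - p) := ⟨_, rfl⟩
  rw [← hvd] at hv ⊢
  have hR : 0 < T * (1 + v) := by positivity
  -- The parabola is tangent to `exp (T * z)` at `z = -v` and meets it at `z = 1`, the atoms of the
  -- extremal law. Its expectation depends only on mean and variance.
  have key : ∀ z, z ≤ 1 → Real.exp (T * z) ≤ Real.exp (-(T * v)) * (1 + T * (z + v) +
      (T * (z + v)) ^ 2 * ((Real.exp (T * (1 + v)) - 1 - T * (1 + v)) / (T * (1 + v)) ^ 2)) := by
    intro z hz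
    have h1 := exp_le_quadratic_of_le (r := T * (z + v)) (R := T * (1 + v))
      (by gcongr) hR
    have h2 : Real.exp (T * z) = Real.exp (-(T * v)) * Real.exp (T * (z + v)) := by
      rw [← Real.exp_add]; congr 1; ring
    rw [h2]
    gcongr
  have k1 := key (-(d * p)) (by nlinarith [mul_nonneg hd hp0])
  have k2 := key (d * (1 - p)) h
  obtain ⟨E, hE⟩ : ∃ E, E = Real.exp (T * (1 + v)) := ⟨_, rfl⟩
  obtain ⟨F, hF⟩ : ∃ F, F = Real.exp (-(T * v)) := ⟨_, rfl⟩
  unfold bennettMGF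
  rw [← hE, ← hF] at k1 k2 ⊢
  refine (add_le_add (mul_le_mul_of_nonneg_left k1 (by linarith))
    (mul_le_mul_of_nonneg_left k2 hp0)).trans (le_of_eq ?_)
  have h1v : 1 + v ≠ 0 := by positivity
  have hT' : T ≠ 0 := hT.ne'
  field_simp
  rw [hvd]
  ring

/-- The parabola is now tangent at `z = 0`, and `1 + x ≤ exp x` gives a bound whose exponent is
additive in the variances. -/
theorem twoPoint_mgf_le_exp {p d T : ℝ} (hp : p ∈ Set.Icc (0 : ℝ) 1) (hd : 0 ≤ d)
    (hT : 0 ≤ T) (h : p = 0 ∨ d * (1 - p) ≤ 1) :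
    (1 - p) * Real.exp (T * (-(d * p))) + p * Real.exp (T * (d * (1 - p))) ≤
      Real.exp (d ^ 2 * p * (1 - p) * (Real.exp T - 1 - T)) := by
  obtain ⟨hp0, hp1⟩ := hp
  rcases h with rfl | h
  · simp
  rcases hT.eq_or_lt with rfl | hT
  · simp
  have key : ∀ z, z ≤ 1 → Real.exp (T * z) ≤ 1 + T * z + z ^ 2 * (Real.exp T - 1 - T) := by
    intro z hz
    have h1 := exp_le_quadratic_of_le (r := T * z) (R := T) (by nlinarith) hT
    refine h1.trans_eq ?_
    field_simp
  have k1 := key (-(d * p)) (by nlinarith [mul_nonneg hd hp0])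
  have k2 := key (d * (1 - p)) h
  refine le_trans ?_ (Real.add_one_le_exp _)
  refine (add_le_add (mul_le_mul_of_nonneg_left k1 (by linarith))
    (mul_le_mul_of_nonneg_left k2 hp0)).trans (le_of_eq ?_)
  ring

theorem hasDerivAt_log_one_add_mul_exp {T v : ℝ} (hv : 0 ≤ v) :
    HasDerivAt (fun v => Real.log (1 + v * Real.exp (T * (1 + v))))
      (Real.exp (T * (1 + v)) * (1 + v * T) / (1 + v * Real.exp (T * (1 + v)))) v := by
  have h1 : HasDerivAt (fun v : ℝ => Real.exp (T * (1 + v))) (Real.exp (T * (1 + v)) * (T * 1)) v :=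
    (((hasDerivAt_id v).const_add 1).const_mul T).exp
  have h2 := (((hasDerivAt_id v).mul h1).const_add 1).log
    (by simp only [id, Pi.mul_apply]; positivity)
  refine h2.congr_deriv ?_
  simp only [id, Pi.mul_apply]
  congr 1
  ring

theorem concaveOn_log_bennettMGF {T : ℝ} (hT : 0 ≤ T) :
    ConcaveOn ℝ (Set.Ici 0) fun v => Real.log (bennettMGF T v) := by
  have heq : Set.EqOn (fun v => -(T * v) + Real.log (1 + v * Real.exp (T * (1 + v))) -
      Real.log (1 + v)) (fun v => Real.log (bennettMGF T v)) (Set.Ici 0) := by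
    intro v hv
    have hv : 0 ≤ v := hv
    simp only [bennettMGF]
    rw [Real.log_div (by positivity) (by positivity), Real.log_mul (by positivity) (by positivity),
      Real.log_exp]
  refine ConcaveOn.congr ?_ heq
  have hd : ∀ v : ℝ, 0 ≤ v → HasDerivAt (fun v => -(T * v) +
      Real.log (1 + v * Real.exp (T * (1 + v))) - Real.log (1 + v))
      (-(T * 1) + Real.exp (T * (1 + v)) * (1 + v * T) / (1 + v * Real.exp (T * (1 + v))) -
        1 / (1 + v)) v := by
    intro v hv
    exact ((((hasDerivAt_id v).const_mul T).neg).add (hasDerivAt_log_one_add_mul_exp hv)).sub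
      (((hasDerivAt_id v).const_add 1).log (by simp only [id]; positivity))
  have hd2 : ∀ v : ℝ, 0 ≤ v → HasDerivAt (fun v => -(T * 1) + Real.exp (T * (1 + v)) * (1 + v * T) /
      (1 + v * Real.exp (T * (1 + v))) - 1 / (1 + v))
      (Real.exp (T * (1 + v)) * (T * (2 + v * T) - Real.exp (T * (1 + v))) /
        (1 + v * Real.exp (T * (1 + v))) ^ 2 + 1 / (1 + v) ^ 2) v := by
    intro v hv
    have h1 : HasDerivAt (fun v : ℝ => Real.exp (T * (1 + v)))
        (Real.exp (T * (1 + v)) * (T * 1)) v :=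
      (((hasDerivAt_id v).const_add 1).const_mul T).exp
    have h2 := h1.mul (((hasDerivAt_id v).mul_const T).const_add 1)
    have h3 := ((hasDerivAt_id v).mul h1).const_add 1
    have hne : 1 + v * Real.exp (T * (1 + v)) ≠ 0 := by positivity
    have hne' : 1 + v ≠ 0 := by positivity
    have h4 := ((h2.div h3 hne).const_add (-(T * 1))).sub
      ((hasDerivAt_const v (1 : ℝ)).div ((hasDerivAt_id v).const_add 1) hne')
    refine h4.congr_deriv ?_
    simp only [id, Pi.mul_apply]
    field_simp
    ring
  refine concaveOn_of_hasDerivWithinAt2_nonpos (convex_Ici 0)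
    (fun v hv => (hd v hv).continuousAt.continuousWithinAt)
    (fun v hv => (hd v (interior_subset hv)).hasDerivWithinAt)
    (fun v hv => (hd2 v (interior_subset hv)).hasDerivWithinAt) ?_
  intro v hv
  have hv : 0 ≤ v := interior_subset hv
  have hw : 0 ≤ T * (1 + v) := by positivity
  obtain ⟨w, hwd⟩ : ∃ w, w = T * (1 + v) := ⟨_, rfl⟩
  have hsinh := Real.self_le_sinh_iff.2 hw
  have hquad := Real.quadratic_le_exp_of_nonneg hw
  rw [Real.sinh_eq, Real.exp_neg] at hsinh
  rw [← hwd] at hw hsinh hquad ⊢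
  have hTw : T = w / (1 + v) := by rw [hwd]; field_simp
  have hu : 0 < Real.exp w := Real.exp_pos w
  obtain ⟨u, hud⟩ : ∃ u, u = Real.exp w := ⟨_, rfl⟩
  rw [← hud] at hu hsinh hquad ⊢
  have hsinh' : 2 * w * u ≤ u ^ 2 - 1 := by
    have := mul_le_mul_of_nonneg_left hsinh (mul_nonneg zero_le_two hu.le)
    field_simp at this
    linarith
  -- The left side equals `(2wu - u² + 1) + vu(2 + 2w + w² - 2u)`: the first bracket is nonpositive
  -- by `w ≤ sinh w`, the second by `1 + w + w²/2 ≤ exp w`.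
  have hcore : u * (w * (2 * (1 + v) + v * w) - u * (1 + v) ^ 2) + (1 + v * u) ^ 2 ≤ 0 := by
    nlinarith [mul_le_mul_of_nonneg_left hquad (mul_nonneg hv hu.le)]
  have : u * (T * (2 + v * T) - u) / (1 + v * u) ^ 2 + 1 / (1 + v) ^ 2 =
      (u * (w * (2 * (1 + v) + v * w) - u * (1 + v) ^ 2) + (1 + v * u) ^ 2) /
        ((1 + v * u) ^ 2 * (1 + v) ^ 2) := by
    have h1 : 1 + v * u ≠ 0 := by positivity
    have h2 : 1 + v ≠ 0 := by positivity
    rw [div_add_div _ _ (by positivity) (by positivity), hTw]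
    congr 1
    field_simp
  rw [this]
  exact div_nonpos_of_nonpos_of_nonneg hcore (by positivity)

theorem prod_bennettMGF_le {n : ℕ} (hn : 0 < n) {T : ℝ} (hT : 0 ≤ T) (v : Fin n → ℝ)
    (hv : ∀ i, 0 ≤ v i) :
    ∏ i, bennettMGF T (v i) ≤ bennettMGF T ((∑ i, v i) / n) ^ n := by
  have hn' : (n : ℝ) ≠ 0 := by positivity
  have h := (concaveOn_log_bennettMGF hT).le_map_sum (t := Finset.univ)
    (w := fun _ : Fin n => (n : ℝ)⁻¹) (p := v) (fun _ _ => by positivity)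
    (by simp [hn']) (fun i _ => hv i)
  simp only [smul_eq_mul, ← Finset.mul_sum] at h
  rw [inv_mul_le_iff₀ (by positivity), inv_mul_eq_div] at h
  have hpos : 0 < bennettMGF T ((∑ i, v i) / n) :=
    bennettMGF_pos (div_nonneg (Finset.sum_nonneg fun i _ => hv i) (by positivity))
  rw [← Real.log_le_log_iff (Finset.prod_pos fun i _ => bennettMGF_pos (hv i)) (by positivity),
    Real.log_prod (fun i _ => (bennettMGF_pos (hv i)).ne'), Real.log_pow]
  exact h

theorem prod_le_average_pow {n : ℕ} (hn : 0 < n) (z : Fin n → ℝ) (hz : ∀ i, 0 ≤ z i) :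
    ∏ i, z i ≤ ((∑ i, z i) / n) ^ n := by
  have hn' : (n : ℝ) ≠ 0 := by positivity
  have h := Real.geom_mean_le_arith_mean_weighted Finset.univ (fun _ : Fin n => (n : ℝ)⁻¹) z
    (fun _ _ => by positivity) (by simp [hn']) (fun i _ => hz i)
  rw [← Finset.mul_sum, inv_mul_eq_div, Real.finsetProd_rpow _ _ (fun i _ => hz i)] at h
  have h2 := pow_le_pow_left₀ (Real.rpow_nonneg (Finset.prod_nonneg fun i _ => hz i) _) h n
  rwa [Real.rpow_inv_natCast_pow (Finset.prod_nonneg fun i _ => hz i) hn.ne'] at h2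

/-! ### Optimising the exponential parameter -/

-- The infimum is at `exp t = q(1-p) / (p(1-q))`, where `t ≥ 0` because `p ≤ q`. For `p = 0 < q` it
-- is approached only as `t → ∞`.
open Filter Topology in
theorem le_of_forall_exp_mgf_le {n : ℕ} {p q R : ℝ} (hp : 0 ≤ p) (hpq : p ≤ q) (hq : q < 1)
    (h : ∀ t : ℝ, 0 ≤ t → R ≤ (Real.exp (-(t * q)) * (1 - p + p * Real.exp t)) ^ n) :
    R ≤ ((p / q) ^ q * ((1 - p) / (1 - q)) ^ (1 - q)) ^ n := by
  rcases hp.eq_or_lt with rfl | hp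
  · rcases hpq.eq_or_lt with rfl | hq0
    · simpa using h 0 le_rfl
    · have hlim : Tendsto (fun t : ℝ => (Real.exp (-(t * q))) ^ n) atTop (𝓝 (0 ^ n)) :=
        (Real.tendsto_exp_neg_atTop_nhds_zero.comp
          (tendsto_id.atTop_mul_const hq0)).pow n
      rw [zero_div, Real.zero_rpow hq0.ne', zero_mul]
      refine ge_of_tendsto hlim (eventually_atTop.2 ⟨0, fun t ht => ?_⟩)
      simpa using h t ht
  have hq0 : 0 < q := hp.trans_le hpq
  have hp1 : 0 < 1 - p := by linarith
  have hq1 : 0 < 1 - q := by linarith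
  refine (h (Real.log (q * (1 - p) / (p * (1 - q)))) (Real.log_nonneg ?_)).trans_eq ?_
  · rw [one_le_div (by positivity)]
    nlinarith
  · congr 1
    rw [Real.exp_log (by positivity)]
    have h1 : 1 - p + p * (q * (1 - p) / (p * (1 - q))) = (1 - p) / (1 - q) := by
      field_simp
      ring
    have h2 : Real.exp (-(Real.log (q * (1 - p) / (p * (1 - q))) * q)) =
        (p / q) ^ q / ((1 - p) / (1 - q)) ^ q := by
      rw [Real.exp_neg, ← Real.rpow_def_of_pos (by positivity),
        ← Real.inv_rpow (by positivity), ← Real.div_rpow (by positivity) (by positivity)]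
      congr 1
      field_simp
    rw [h1, h2, Real.rpow_sub (by positivity), Real.rpow_one]
    ring

-- This is the boundary case `q = 1`, where the limit `t → ∞` replaces a minimiser.
open Filter Topology in
theorem le_pow_of_forall_exp_mgf_le {n : ℕ} {p R : ℝ}
    (h : ∀ t : ℝ, 0 ≤ t → R ≤ (Real.exp (-t) * (1 - p + p * Real.exp t)) ^ n) :
    R ≤ p ^ n := by
  have hlim : Tendsto (fun t : ℝ => (Real.exp (-t) * (1 - p) + p) ^ n) atTop
      (𝓝 ((0 * (1 - p) + p) ^ n)) :=
    ((Real.tendsto_exp_neg_atTop_nhds_zero.mul_const _).add_const _).pow n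
  rw [zero_mul, zero_add] at hlim
  refine ge_of_tendsto hlim (eventually_atTop.2 ⟨0, fun t ht => (h t ht).trans_eq ?_⟩)
  congr 1
  have : Real.exp (-t) * Real.exp t = 1 := by rw [← Real.exp_add]; simp
  linear_combination p * this

open Filter Topology in
theorem nonpos_of_forall_le_exp_neg {l R : ℝ} (hl : 0 < l)
    (h : ∀ t : ℝ, 0 ≤ t → R ≤ Real.exp (-(t * l))) : R ≤ 0 :=
  ge_of_tendsto (Real.tendsto_exp_neg_atTop_nhds_zero.comp (tendsto_id.atTop_mul_const hl))
    (eventually_atTop.2 ⟨0, fun t ht => h t ht⟩)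

/-- The difference of the two sides and its derivative vanish at `0`; the second derivative is
`1/(1+x) - 27/(3+x)³`, nonnegative by AM-GM for `1, 1, 1+x`. -/
theorem bernstein_le_bennett {u : ℝ} (hu : 0 ≤ u) :
    u ^ 2 / (2 + 2 / 3 * u) ≤ (1 + u) * Real.log (1 + u) - u := by
  have hd1 : ∀ x : ℝ, 0 ≤ x → HasDerivAt (fun x => Real.log (1 + x) -
      3 * x * (6 + x) / (2 * (3 + x) ^ 2)) (1 / (1 + x) - 27 / (3 + x) ^ 3) x := by
    intro x hx
    have h1 : HasDerivAt (fun x : ℝ => Real.log (1 + x)) (1 / (1 + x)) x :=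
      ((hasDerivAt_id x).const_add 1).log (by simp only [id]; positivity)
    have h2 : HasDerivAt (fun x : ℝ => 3 * x * (6 + x)) (3 * 1 * (6 + x) + 3 * x * 1) x :=
      ((hasDerivAt_id x).const_mul 3).mul ((hasDerivAt_id x).const_add 6)
    have h3 : HasDerivAt (fun x : ℝ => 2 * (3 + x) ^ 2) (2 * ((2 : ℕ) * (3 + x) ^ (2 - 1) * 1)) x :=
      (((hasDerivAt_id x).const_add 3).pow 2).const_mul 2
    refine (h1.sub (h2.div h3 (by positivity))).congr_deriv ?_
    field_simp
    ring
  have hd2 : ∀ x : ℝ, 0 ≤ x → HasDerivAt (fun x => (1 + x) * Real.log (1 + x) - x -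
      x ^ 2 / (2 + 2 / 3 * x)) (Real.log (1 + x) - 3 * x * (6 + x) / (2 * (3 + x) ^ 2)) x := by
    intro x hx
    have h0 : HasDerivAt (fun x : ℝ => 1 + x) 1 x := (hasDerivAt_id x).const_add 1
    have h1 : HasDerivAt (fun x : ℝ => Real.log (1 + x)) (1 / (1 + x)) x :=
      h0.log (by positivity)
    have h3 : HasDerivAt (fun x : ℝ => 2 + 2 / 3 * x) (2 / 3 * 1) x :=
      ((hasDerivAt_id x).const_mul (2 / 3)).const_add 2
    refine (((h0.mul h1).sub (hasDerivAt_id x)).sub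
      ((hasDerivAt_pow 2 x).div h3 (by positivity))).congr_deriv ?_
    field_simp
    ring
  have hm1 := monotoneOn_of_deriv_nonneg (convex_Ici (0 : ℝ))
    (fun x hx => (hd1 x hx).continuousAt.continuousWithinAt)
    (fun x hx => (hd1 x (interior_subset hx)).differentiableAt.differentiableWithinAt) (by
      intro x hx
      have hx : 0 ≤ x := interior_subset hx
      rw [(hd1 x hx).deriv, sub_nonneg, div_le_div_iff₀ (by positivity) (by positivity)]
      nlinarith [pow_nonneg hx 3, pow_nonneg hx 2])
  have hm2 := monotoneOn_of_deriv_nonneg (convex_Ici (0 : ℝ))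
    (fun x hx => (hd2 x hx).continuousAt.continuousWithinAt)
    (fun x hx => (hd2 x (interior_subset hx)).differentiableAt.differentiableWithinAt) (by
      intro x hx
      have hx : 0 ≤ x := interior_subset hx
      rw [(hd2 x hx).deriv]
      simpa using hm1 Set.self_mem_Ici hx hx)
  have := hm2 Set.self_mem_Ici hu hu
  simp only [add_zero, Real.log_one, mul_zero, sub_self, ne_eq, OfNat.ofNat_ne_zero,
    not_false_eq_true, zero_pow, zero_div] at this
  linarith

theorem min_div_three_le_bernstein {u : ℝ} (hu : 0 ≤ u) :
    min (u ^ 2) u / 3 ≤ u ^ 2 / (2 + 2 / 3 * u) := by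
  rw [div_le_div_iff₀ (by positivity) (by positivity)]
  rcases le_total u 1 with h | h
  · nlinarith [min_le_left (u ^ 2) u, sq_nonneg u]
  · nlinarith [min_le_right (u ^ 2) u]

/-! ### Two-valued variables and negative correlation -/

section TwoValued

variable {Ω : Type*} [MeasurableSpace Ω] {P : Measure Ω}

theorem ae_comp_eq_indicator {X Y : Ω → ℝ} {a b : ℝ} (hX : ∀ᵐ ω ∂P, X ω = 0 ∨ X ω = 1)
    (hY : ∀ᵐ ω ∂P, (X ω = 0 → Y ω = a) ∧ (X ω = 1 → Y ω = b)) (F : ℝ → ℝ) :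
    (fun ω => F (Y ω)) =ᵐ[P]
      fun ω => (F b - F a) * {ω | X ω = 1}.indicator (fun _ => (1 : ℝ)) ω + F a := by
  filter_upwards [hX, hY] with ω h1 h2
  rcases h1 with h | h
  · simp [h, h2.1 h]
  · simp [h, h2.2 h]

/-- An almost sure bound constrains the upper value only if it is attained with positive
probability; hence the alternative `p = 0` in the Bennett lemmas. -/
theorem prob_eq_zero_or_le_of_ae_le {X Y : Ω → ℝ} {a b c : ℝ}
    (hY : ∀ᵐ ω ∂P, (X ω = 0 → Y ω = a) ∧ (X ω = 1 → Y ω = b)) (h : ∀ᵐ ω ∂P, Y ω ≤ c) :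
    P.real {ω | X ω = 1} = 0 ∨ b ≤ c := by
  by_cases hc : b ≤ c
  · exact Or.inr hc
  · left
    have h0 : P {ω | X ω = 1} = 0 := by
      refine measure_eq_zero_iff_ae_notMem.2 ?_
      filter_upwards [hY, h] with ω h1 h2 h3
      rw [h1.2 h3] at h2
      exact hc h2
    simp [measureReal_def, h0]

theorem aemeasurable_of_twoValued {X Y : Ω → ℝ} {a b : ℝ} (hXm : Measurable X)
    (hX : ∀ᵐ ω ∂P, X ω = 0 ∨ X ω = 1)
    (hY : ∀ᵐ ω ∂P, (X ω = 0 → Y ω = a) ∧ (X ω = 1 → Y ω = b)) : AEMeasurable Y P := by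
  refine AEMeasurable.congr ?_ (ae_comp_eq_indicator hX hY id).symm
  have hA : MeasurableSet {ω | X ω = 1} := hXm (measurableSet_singleton 1)
  exact (((measurable_const.indicator hA).const_mul _).add_const _).aemeasurable

variable [IsProbabilityMeasure P]

theorem integrable_comp_of_twoValued {X Y : Ω → ℝ} {a b : ℝ} (hXm : Measurable X)
    (hX : ∀ᵐ ω ∂P, X ω = 0 ∨ X ω = 1)
    (hY : ∀ᵐ ω ∂P, (X ω = 0 → Y ω = a) ∧ (X ω = 1 → Y ω = b)) (F : ℝ → ℝ) :
    Integrable (fun ω => F (Y ω)) P := by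
  refine Integrable.congr ?_ (ae_comp_eq_indicator hX hY F).symm
  have hA : MeasurableSet {ω | X ω = 1} := hXm (measurableSet_singleton 1)
  exact (((integrable_const _).indicator hA).const_mul _).add (integrable_const _)

theorem integral_comp_of_twoValued {X Y : Ω → ℝ} {a b : ℝ} (hXm : Measurable X)
    (hX : ∀ᵐ ω ∂P, X ω = 0 ∨ X ω = 1)
    (hY : ∀ᵐ ω ∂P, (X ω = 0 → Y ω = a) ∧ (X ω = 1 → Y ω = b)) (F : ℝ → ℝ) :
    ∫ ω, F (Y ω) ∂P =
      (1 - P.real {ω | X ω = 1}) * F a + P.real {ω | X ω = 1} * F b := by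
  have hA : MeasurableSet {ω | X ω = 1} := hXm (measurableSet_singleton 1)
  rw [integral_congr_ae (ae_comp_eq_indicator hX hY F), integral_add
    (((integrable_const _).indicator hA).const_mul _) (integrable_const _), integral_const_mul,
    integral_indicator_const _ hA]
  simp
  ring

theorem variance_of_twoValued {X Y : Ω → ℝ} {a b : ℝ} (hXm : Measurable X)
    (hX : ∀ᵐ ω ∂P, X ω = 0 ∨ X ω = 1)
    (hY : ∀ᵐ ω ∂P, (X ω = 0 → Y ω = a) ∧ (X ω = 1 → Y ω = b)) :
    variance Y P = (b - a) ^ 2 * P.real {ω | X ω = 1} * (1 - P.real {ω | X ω = 1}) := by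
  rw [variance_eq_integral (aemeasurable_of_twoValued hXm hX hY),
    integral_comp_of_twoValued hXm hX hY fun y => (y - ∫ ω, Y ω ∂P) ^ 2,
    integral_comp_of_twoValued hXm hX hY fun y => y]
  ring

theorem twoPoint_mgf_le_hoeffding {X Y : Ω → ℝ} {a b : ℝ} (hab : a ≤ b) (hXm : Measurable X)
    (hX : ∀ᵐ ω ∂P, X ω = 0 ∨ X ω = 1)
    (hY : ∀ᵐ ω ∂P, (X ω = 0 → Y ω = a) ∧ (X ω = 1 → Y ω = b)) (t : ℝ) :
    (1 - P.real {ω | X ω = 1}) * Real.exp (t * a) + P.real {ω | X ω = 1} * Real.exp (t * b) ≤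
      Real.exp (t * ∫ ω, Y ω ∂P) * Real.exp ((b - a) ^ 2 * t ^ 2 / 8) := by
  have hmem : ∀ᵐ ω ∂P, Y ω ∈ Set.Icc a b := by
    filter_upwards [hX, hY] with ω h1 h2
    rcases h1 with h | h
    · simp [h2.1 h, hab]
    · simp [h2.2 h, hab]
  have h := (hasSubgaussianMGF_of_mem_Icc (aemeasurable_of_twoValued hXm hX hY) hmem).mgf_le t
  rw [mgf, integral_comp_of_twoValued hXm hX hY fun y => Real.exp (t * (y - ∫ ω, Y ω ∂P))] at h
  have h2 := mul_le_mul_of_nonneg_left h (Real.exp_pos (t * ∫ ω, Y ω ∂P)).le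
  have h3 : ∀ y, Real.exp (t * y) =
      Real.exp (t * ∫ ω, Y ω ∂P) * Real.exp (t * (y - ∫ ω, Y ω ∂P)) := by
    intro y
    rw [← Real.exp_add]
    congr 1
    ring
  rw [h3 a, h3 b]
  refine (le_of_eq (by ring)).trans (h2.trans_eq ?_)
  congr 2
  simp only [NNReal.coe_pow, NNReal.coe_div, coe_nnnorm, NNReal.coe_ofNat, div_pow, Real.norm_eq_abs,
    sq_abs]
  ring

variable {n : ℕ} {X Y : Fin n → Ω → ℝ} {a b : Fin n → ℝ}

/-- The only use of negative correlation. Both sides expand over subsets with the same coefficients,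
which are nonnegative because each `F i` is nonnegative at `a i` and no smaller at `b i`. -/
theorem integral_prod_comp_le (hX : IsBinaryFamily P X) (hneg : OneNegativelyCorrelated P X)
    (hY : ∀ i, ∀ᵐ ω ∂P, (X i ω = 0 → Y i ω = a i) ∧ (X i ω = 1 → Y i ω = b i))
    (F : Fin n → ℝ → ℝ) (h0 : ∀ i, 0 ≤ F i (a i)) (hF : ∀ i, F i (a i) ≤ F i (b i)) :
    Integrable (fun ω => ∏ i, F i (Y i ω)) P ∧ ∫ ω, ∏ i, F i (Y i ω) ∂P ≤
      ∏ i, ((1 - P.real {ω | X i ω = 1}) * F i (a i) + P.real {ω | X i ω = 1} * F i (b i)) := by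
  have hA : ∀ i, MeasurableSet {ω | X i ω = 1} := fun i => (hX i).1 (measurableSet_singleton 1)
  have hAI : ∀ I : Finset (Fin n), MeasurableSet {ω | ∀ i ∈ I, X i ω = 1} := by
    intro I
    have : {ω | ∀ i ∈ I, X i ω = 1} = ⋂ i ∈ I, {ω | X i ω = 1} := by ext; simp
    rw [this]
    exact Finset.measurableSet_biInter I fun i _ => hA i
  have hprod : (fun ω => ∏ i, F i (Y i ω)) =ᵐ[P] fun ω => ∑ I : Finset (Fin n),
      {ω | ∀ i ∈ I, X i ω = 1}.indicator (fun _ => (1 : ℝ)) ω *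
        ((∏ i ∈ I, (F i (b i) - F i (a i))) * ∏ i ∈ Iᶜ, F i (a i)) := by
    have hall := ae_all_iff.2 fun i => ae_comp_eq_indicator (hX i).2 (hY i) (F i)
    filter_upwards [hall] with ω hω
    simp only [hω, Fintype.prod_add, Finset.prod_mul_distrib]
    refine Finset.sum_congr rfl fun I _ => ?_
    have : ∏ i ∈ I, {ω | X i ω = 1}.indicator (fun _ => (1 : ℝ)) ω =
        {ω | ∀ i ∈ I, X i ω = 1}.indicator (fun _ => (1 : ℝ)) ω := by
      classical
      simp only [Set.indicator_apply, Set.mem_ofPred_eq]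
      rw [Finset.prod_ite_zero]
      simp
    rw [this]
    ring
  have hint : ∀ I ∈ (Finset.univ : Finset (Finset (Fin n))), Integrable (fun ω =>
      {ω | ∀ i ∈ I, X i ω = 1}.indicator (fun _ => (1 : ℝ)) ω *
        ((∏ i ∈ I, (F i (b i) - F i (a i))) * ∏ i ∈ Iᶜ, F i (a i))) P := fun I _ =>
    ((integrable_const _).indicator (hAI I)).mul_const _
  refine ⟨(integrable_finsetSum _ hint).congr hprod.symm, ?_⟩
  rw [integral_congr_ae hprod, integral_finsetSum _ hint]
  have hrw : ∀ i, (1 - P.real {ω | X i ω = 1}) * F i (a i) + P.real {ω | X i ω = 1} * F i (b i) =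
      P.real {ω | X i ω = 1} * (F i (b i) - F i (a i)) + F i (a i) := fun i => by ring
  simp only [hrw, Fintype.prod_add, Finset.prod_mul_distrib]
  refine Finset.sum_le_sum fun I _ => ?_
  rw [integral_mul_const, integral_indicator_const _ (hAI I), smul_eq_mul, mul_one, mul_assoc]
  exact mul_le_mul_of_nonneg_right (hneg I) (mul_nonneg
    (Finset.prod_nonneg fun i _ => sub_nonneg.2 (hF i)) (Finset.prod_nonneg fun i _ => h0 i))

theorem tail_le_of_oneNegativelyCorrelated (hX : IsBinaryFamily P X)
    (hneg : OneNegativelyCorrelated P X) (hab : ∀ i, a i ≤ b i)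
    (hY : ∀ i, ∀ᵐ ω ∂P, (X i ω = 0 → Y i ω = a i) ∧ (X i ω = 1 → Y i ω = b i))
    {S : Ω → ℝ} (hS : ∀ ω, S ω = ∑ i, Y i ω) (x : ℝ) {t : ℝ} (ht : 0 ≤ t) :
    P.real {ω | x ≤ S ω} ≤ Real.exp (-(t * x)) *
      ∏ i, ((1 - P.real {ω | X i ω = 1}) * Real.exp (t * a i) +
        P.real {ω | X i ω = 1} * Real.exp (t * b i)) := by
  have h := integral_prod_comp_le hX hneg hY (fun _ y => Real.exp (t * y))
    (fun i => (Real.exp_pos _).le)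
    (fun i => Real.exp_le_exp.2 (mul_le_mul_of_nonneg_left (hab i) ht))
  have hexp : ∀ ω, ∏ i, Real.exp (t * Y i ω) = Real.exp (t * S ω) := by
    intro ω
    rw [hS, Finset.mul_sum, Real.exp_sum]
  simp only [hexp] at h
  refine (measure_ge_le_exp_mul_mgf x ht h.1).trans ?_
  rw [neg_mul]
  exact mul_le_mul_of_nonneg_left h.2 (Real.exp_pos _).le

end TwoValued

/-! ### Tails from a centred Poisson transform -/

section PoissonTail

variable {w y R : ℝ}

/-- The minimiser is `T = log (1 + y / w)`. It serves both `w = m`, `y = l` and `w = s / β ^ 2`, `y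
= l / β`. -/
theorem le_exp_neg_bennett (hw : 0 < w) (hy : 0 ≤ y)
    (h : ∀ T : ℝ, 0 ≤ T → R ≤ Real.exp (-(T * y)) * Real.exp (w * (Real.exp T - 1 - T))) :
    R ≤ Real.exp (-(w * ((1 + y / w) * Real.log (1 + y / w) - y / w))) := by
  have hu : 0 ≤ y / w := by positivity
  refine (h (Real.log (1 + y / w)) (Real.log_nonneg (by linarith))).trans_eq ?_
  rw [← Real.exp_add, Real.exp_log (by positivity)]
  congr 1
  field_simp
  ring

theorem le_zero_of_poissonTail (hy : 0 < y)
    (h : ∀ T : ℝ, 0 ≤ T → R ≤ Real.exp (-(T * y)) * Real.exp (0 * (Real.exp T - 1 - T))) :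
    R ≤ 0 :=
  nonpos_of_forall_le_exp_neg hy fun t ht => by simpa using h t ht

theorem le_one_of_poissonTail
    (h : ∀ T : ℝ, 0 ≤ T → R ≤ Real.exp (-(T * y)) * Real.exp (w * (Real.exp T - 1 - T))) :
    R ≤ 1 := by
  simpa using h 0 le_rfl

theorem le_exp_neg_bernstein (hw : 0 ≤ w) (hy : 0 ≤ y)
    (h : ∀ T : ℝ, 0 ≤ T → R ≤ Real.exp (-(T * y)) * Real.exp (w * (Real.exp T - 1 - T))) :
    R ≤ Real.exp (-(y ^ 2 / (2 * w + 2 / 3 * y))) := by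
  rcases hw.eq_or_lt with rfl | hw
  · rcases hy.eq_or_lt with rfl | hy
    · simpa using le_one_of_poissonTail h
    · exact (le_zero_of_poissonTail hy h).trans (Real.exp_pos _).le
  refine (le_exp_neg_bennett hw hy h).trans (Real.exp_le_exp.2 (neg_le_neg ?_))
  have hb := bernstein_le_bennett (u := y / w) (by positivity)
  refine le_trans (le_of_eq ?_) (mul_le_mul_of_nonneg_left hb hw.le)
  field_simp

theorem le_exp_neg_minSqDiv (hw : 0 ≤ w) (hy : 0 ≤ y)
    (h : ∀ T : ℝ, 0 ≤ T → R ≤ Real.exp (-(T * y)) * Real.exp (w * (Real.exp T - 1 - T))) :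
    R ≤ Real.exp (-(1 / 3 * minSqDiv y w y)) := by
  unfold minSqDiv
  rcases hw.eq_or_lt with rfl | hw
  · rcases hy.eq_or_lt with rfl | hy
    · simpa using le_one_of_poissonTail h
    · exact (le_zero_of_poissonTail hy h).trans (Real.exp_pos _).le
  rw [if_neg hw.ne']
  refine (le_exp_neg_bernstein hw.le hy h).trans (Real.exp_le_exp.2 (neg_le_neg ?_))
  have hb := mul_le_mul_of_nonneg_left (min_div_three_le_bernstein (u := y / w) (by positivity))
    hw.le
  refine (le_of_eq ?_).trans (hb.trans_eq ?_)
  · rw [mul_div_assoc', mul_min_of_nonneg _ _ hw.le, one_div_mul_eq_div]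
    congr 2 <;> field_simp
  · field_simp

end PoissonTail

/-! ### Bounds from the mean -/

section Mean

variable {n : ℕ} {p a b : Fin n → ℝ} {m x R : ℝ}

theorem twoPoint_mgf_le_linear {p a b t : ℝ} (hp : p ∈ Set.Icc (0 : ℝ) 1)
    (ha : a ∈ Set.Icc (0 : ℝ) 1) (hb : b ∈ Set.Icc (0 : ℝ) 1) :
    (1 - p) * Real.exp (t * a) + p * Real.exp (t * b) ≤
      1 + ((1 - p) * a + p * b) * (Real.exp t - 1) := by
  -- Convexity: on `[0,1]` the graph lies below its chord.
  have key : ∀ z ∈ Set.Icc (0 : ℝ) 1, Real.exp (t * z) ≤ 1 + z * (Real.exp t - 1) := by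
    intro z hz
    have := convexOn_exp.2 (Set.mem_univ 0) (Set.mem_univ t) (sub_nonneg.2 hz.2) hz.1
      (sub_add_cancel 1 z)
    simp only [smul_eq_mul, mul_zero, zero_add, Real.exp_zero, mul_one] at this
    rw [mul_comm t z]
    linarith
  have h1 := mul_le_mul_of_nonneg_left (key a ha) (sub_nonneg.2 hp.2)
  have h2 := mul_le_mul_of_nonneg_left (key b hb) hp.1
  linarith

/-- The Poisson, binomial (by AM-GM) and trivial estimates; the last yields the bound `0` beyond
`n`. The mean may be raised to `m` because `exp t - 1 ≥ 0`. -/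
theorem prod_twoPoint_le_of_mean (hp : ∀ i, p i ∈ Set.Icc (0 : ℝ) 1)
    (ha : ∀ i, a i ∈ Set.Icc (0 : ℝ) 1) (hb : ∀ i, b i ∈ Set.Icc (0 : ℝ) 1)
    (hm : ∑ i, ((1 - p i) * a i + p i * b i) ≤ m) {t : ℝ} (ht : 0 ≤ t) :
    ∏ i, ((1 - p i) * Real.exp (t * a i) + p i * Real.exp (t * b i)) ≤
        Real.exp (m * (Real.exp t - 1)) ∧
    (0 < n → ∏ i, ((1 - p i) * Real.exp (t * a i) + p i * Real.exp (t * b i)) ≤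
      (1 + m / n * (Real.exp t - 1)) ^ n) ∧
    ∏ i, ((1 - p i) * Real.exp (t * a i) + p i * Real.exp (t * b i)) ≤ Real.exp (t * n) := by
  have h0 : ∀ i, 0 ≤ (1 - p i) * Real.exp (t * a i) + p i * Real.exp (t * b i) := fun i =>
    add_nonneg (mul_nonneg (sub_nonneg.2 (hp i).2) (Real.exp_pos _).le)
      (mul_nonneg (hp i).1 (Real.exp_pos _).le)
  have het : 0 ≤ Real.exp t - 1 := sub_nonneg.2 (Real.one_le_exp ht)
  have h1 := fun i => twoPoint_mgf_le_linear (t := t) (hp i) (ha i) (hb i)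
  refine ⟨?_, fun hn => ?_, ?_⟩
  · refine (Finset.prod_le_prod (fun i _ => h0 i) fun i _ =>
      (h1 i).trans ((add_comm _ _).trans_le (Real.add_one_le_exp _))).trans ?_
    rw [← Real.exp_sum, ← Finset.sum_mul]
    exact Real.exp_le_exp.2 (mul_le_mul_of_nonneg_right hm het)
  · have hn' : (0 : ℝ) < n := by exact_mod_cast hn
    refine (Finset.prod_le_prod (fun i _ => h0 i) fun i _ => h1 i).trans ?_
    have h2 : ∀ i, 0 ≤ 1 + ((1 - p i) * a i + p i * b i) * (Real.exp t - 1) := fun i =>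
      (h0 i).trans (h1 i)
    refine (prod_le_average_pow hn _ h2).trans (pow_le_pow_left₀
      (div_nonneg (Finset.sum_nonneg fun i _ => h2 i) hn'.le) ?_ n)
    rw [Finset.sum_add_distrib, ← Finset.sum_mul, div_le_iff₀ hn']
    have := mul_le_mul_of_nonneg_right hm het
    have e : (1 + m / n * (Real.exp t - 1)) * n = n + m * (Real.exp t - 1) := by field_simp
    rw [e]
    simpa using this
  · have h2 : ∀ i, (1 - p i) * Real.exp (t * a i) + p i * Real.exp (t * b i) ≤ Real.exp t := by
      intro i
      have e1 : Real.exp (t * a i) ≤ Real.exp t :=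
        Real.exp_le_exp.2 (mul_le_of_le_one_right ht (ha i).2)
      have e2 : Real.exp (t * b i) ≤ Real.exp t :=
        Real.exp_le_exp.2 (mul_le_of_le_one_right ht (hb i).2)
      have := mul_le_mul_of_nonneg_left e1 (sub_nonneg.2 (hp i).2)
      have := mul_le_mul_of_nonneg_left e2 (hp i).1
      linarith
    refine (Finset.prod_le_prod (fun i _ => h0 i) fun i _ => h2 i).trans_eq ?_
    rw [Finset.prod_const, Finset.card_univ, Fintype.card_fin, ← Real.exp_nat_mul, mul_comm]

theorem le_chernoffAdd {l : ℝ} (hm : 0 ≤ m) (hl : 0 ≤ l)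
    (h1 : 0 < n → ∀ t : ℝ, 0 ≤ t →
      R ≤ Real.exp (-(t * (m + l))) * (1 + m / n * (Real.exp t - 1)) ^ n)
    (h2 : ∀ t : ℝ, 0 ≤ t → R ≤ Real.exp (-(t * (m + l))) * Real.exp (t * n)) :
    R ≤ chernoffAdd n m l := by
  -- Rewrites the bound as an `n`-th power with success probability `m / n` and threshold `q` per
  -- variable.
  have hpow : ∀ q t : ℝ, 0 < n → q = (m + l) / n →
      Real.exp (-(t * (m + l))) * (1 + m / n * (Real.exp t - 1)) ^ n =
        (Real.exp (-(t * q)) * (1 - m / n + m / n * Real.exp t)) ^ n := by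
    intro q t hn hq
    have hn' : (0 : ℝ) < n := by exact_mod_cast hn
    rw [mul_pow, ← Real.exp_nat_mul, hq]
    congr 2
    · field_simp
    · ring
  unfold chernoffAdd
  split_ifs with hc1 hc2
  · refine nonpos_of_forall_le_exp_neg (l := m + l - n) (by linarith) fun t ht => ?_
    refine (h2 t ht).trans_eq ?_
    rw [← Real.exp_add]
    congr 1
    ring
  · rcases Nat.eq_zero_or_pos n with rfl | hn
    · simpa using h2 0 le_rfl
    · have hn' : (0 : ℝ) < n := by exact_mod_cast hn
      refine le_pow_of_forall_exp_mgf_le fun t ht => (h1 hn t ht).trans_eq ?_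
      rw [hpow 1 t hn (by rw [hc2]; field_simp; ring), mul_one]
  · have hlt : m + l < n := by
      have := lt_of_le_of_ne (not_lt.1 hc1) hc2
      linarith
    have hn' : (0 : ℝ) < n := by linarith
    have hn : 0 < n := by exact_mod_cast hn'
    have h := le_of_forall_exp_mgf_le (n := n) (p := m / n) (q := (m + l) / n) (R := R)
      (by positivity) (by gcongr; linarith) ((div_lt_one hn').2 hlt)
      fun t ht => (h1 hn t ht).trans_eq (hpow _ t hn rfl)
    refine h.trans_eq ?_
    have e1 : m / n / ((m + l) / n) = m / (m + l) := div_div_div_cancel_right₀ hn'.ne' _ _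
    have e2 : (1 - m / n) / (1 - (m + l) / n) = (n - m) / (n - m - l) := by
      rw [one_sub_div hn'.ne', one_sub_div hn'.ne', div_div_div_cancel_right₀ hn'.ne', sub_sub]
    have p1 : 0 ≤ m / (m + l) := by positivity
    have p2 : 0 ≤ (n - m) / (n - m - l) := div_nonneg (by linarith) (by linarith)
    rw [e1, e2, mul_pow, ← Real.rpow_mul_natCast p1, ← Real.rpow_mul_natCast p2]
    congr 2 <;> field_simp
    ring

theorem le_chernoffAddExp {l : ℝ} (hm : 0 ≤ m) (hl : 0 ≤ l)
    (h : ∀ t : ℝ, 0 ≤ t → R ≤ Real.exp (-(t * l)) * Real.exp (m * (Real.exp t - 1 - t))) :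
    R ≤ chernoffAddExp m l := by
  unfold chernoffAddExp
  rcases hm.eq_or_lt with rfl | hm
  · rw [if_pos rfl]
    split_ifs with hl0
    · exact le_one_of_poissonTail h
    · exact le_zero_of_poissonTail (lt_of_le_of_ne hl (Ne.symm hl0)) h
  · rw [if_neg hm.ne']
    refine (le_exp_neg_bennett hm hl h).trans_eq ?_
    congr 1
    field_simp
    ring

theorem chernoffAddExp_eq {l : ℝ} (hm : 0 ≤ m) (hl : 0 ≤ l) :
    chernoffAddExp m l = Real.exp l * (m / (m + l)) ^ (m + l) := by
  unfold chernoffAddExp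
  rcases hm.eq_or_lt with rfl | hm
  · rw [if_pos rfl]
    split_ifs with hl0
    · simp [hl0]
    · simp [Real.zero_rpow hl0]
  · rw [if_neg hm.ne', Real.rpow_def_of_pos (by positivity), ← Real.exp_add]
    have : m / (m + l) = (1 + l / m)⁻¹ := by field_simp
    rw [this, Real.log_inv]
    congr 1
    ring

theorem chernoffMult_eq_chernoffAdd {δ : ℝ} (hm : 0 < m) :
    chernoffMult n m δ = chernoffAdd n m (δ * m) := by
  have e1 : ((n : ℝ) < (1 + δ) * m) = ((n : ℝ) - m < δ * m) := by
    rw [sub_lt_iff_lt_add]; ring_nf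
  have e2 : ((1 + δ) * m = n) = (δ * m = n - m) := by
    rw [eq_sub_iff_add_eq]; ring_nf
  unfold chernoffMult chernoffAdd
  simp only [e1, e2]
  have e3 : m / (m + δ * m) = 1 / (1 + δ) := by
    rw [show m + δ * m = (1 + δ) * m by ring, div_mul_cancel_right₀ hm.ne', one_div]
  have e4 : m + δ * m = (1 + δ) * m := by ring
  have e5 : (n : ℝ) - m - δ * m = n - (1 + δ) * m := by ring
  rw [e3, e4, e5]

end Mean

/-! ### Bounds from the variance -/

section Variance

variable {n : ℕ} {R : ℝ}

theorem twoPoint_mgf_le_exp_of_le {p d T : ℝ} (hp : p ∈ Set.Icc (0 : ℝ) 1) (hd : 0 ≤ d)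
    (hT : 0 ≤ T) (h : p = 0 ∨ d * (1 - p) ≤ 1) :
    (1 - p) * Real.exp (T * (-(d * p))) + p * Real.exp (T * (d * (1 - p))) ≤ Real.exp T := by
  rcases h with rfl | h
  · simpa using hT
  have e1 : Real.exp (T * (-(d * p))) ≤ Real.exp T :=
    Real.exp_le_exp.2 (by nlinarith [mul_nonneg hT (mul_nonneg hd hp.1)])
  have e2 : Real.exp (T * (d * (1 - p))) ≤ Real.exp T :=
    Real.exp_le_exp.2 (mul_le_of_le_one_right hT h)
  have := mul_le_mul_of_nonneg_left e1 (sub_nonneg.2 hp.2)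
  have := mul_le_mul_of_nonneg_left e2 hp.1
  linarith

/-- `Q` is the product of the transforms after centring and division by `β`, so that deviations are
at most `1` and the variances sum to `s / β ^ 2`. -/
theorem prod_twoPoint_le_of_variance {p a b : Fin n → ℝ} {β s : ℝ} (hβ : 0 < β)
    (hp : ∀ i, p i ∈ Set.Icc (0 : ℝ) 1) (hab : ∀ i, a i ≤ b i)
    (hle : ∀ i, p i = 0 ∨ (b i - a i) * (1 - p i) ≤ β)
    (hs : s = ∑ i, (b i - a i) ^ 2 * p i * (1 - p i)) {T : ℝ} (hT : 0 ≤ T) :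
    ∃ Q : ℝ, ∏ i, ((1 - p i) * Real.exp (T / β * a i) + p i * Real.exp (T / β * b i)) =
      Real.exp (T / β * ∑ i, ((1 - p i) * a i + p i * b i)) * Q ∧
      (0 < n → Q ≤ bennettMGF T (s / (n * β ^ 2)) ^ n) ∧
      Q ≤ Real.exp (s / β ^ 2 * (Real.exp T - 1 - T)) ∧
      Q ≤ Real.exp (T * n) := by
  obtain ⟨d, hd⟩ : ∃ d : Fin n → ℝ, ∀ i, d i = (b i - a i) / β := ⟨_, fun _ => rfl⟩
  have hd0 : ∀ i, 0 ≤ d i := fun i => by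
    rw [hd]
    exact div_nonneg (sub_nonneg.2 (hab i)) hβ.le
  have hd1 : ∀ i, p i = 0 ∨ d i * (1 - p i) ≤ 1 := fun i => (hle i).imp id fun h => by
    rwa [hd, div_mul_eq_mul_div, div_le_one hβ]
  have hp1 : ∀ i, 0 ≤ 1 - p i := fun i => sub_nonneg.2 (hp i).2
  have h0 : ∀ i, 0 ≤ (1 - p i) * Real.exp (T * (-(d i * p i))) +
      p i * Real.exp (T * (d i * (1 - p i))) := fun i =>
    add_nonneg (mul_nonneg (hp1 i) (Real.exp_pos _).le) (mul_nonneg (hp i).1 (Real.exp_pos _).le)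
  have hsum : ∑ i, d i ^ 2 * p i * (1 - p i) = s / β ^ 2 := by
    rw [hs, Finset.sum_div]
    refine Finset.sum_congr rfl fun i _ => ?_
    rw [hd]
    ring
  refine ⟨∏ i, ((1 - p i) * Real.exp (T * (-(d i * p i))) + p i * Real.exp (T * (d i * (1 - p i)))),
    ?_, fun hn => ?_, ?_, ?_⟩
  · rw [Finset.mul_sum, Real.exp_sum, ← Finset.prod_mul_distrib]
    refine Finset.prod_congr rfl fun i _ => ?_
    rw [mul_add, mul_left_comm, ← Real.exp_add, mul_left_comm, ← Real.exp_add, hd]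
    congr 3 <;> ring
  · refine (Finset.prod_le_prod (fun i _ => h0 i) fun i _ =>
      twoPoint_mgf_le_bennettMGF (hp i) (hd0 i) hT (hd1 i)).trans ?_
    have h := prod_bennettMGF_le hn hT (fun i => d i ^ 2 * p i * (1 - p i))
      fun i => mul_nonneg (mul_nonneg (sq_nonneg _) (hp i).1) (hp1 i)
    rwa [hsum, div_div, mul_comm (β ^ 2)] at h
  · refine (Finset.prod_le_prod (fun i _ => h0 i) fun i _ =>
      twoPoint_mgf_le_exp (hp i) (hd0 i) hT (hd1 i)).trans_eq ?_
    rw [← Real.exp_sum, ← Finset.sum_mul, hsum]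
  · refine (Finset.prod_le_prod (fun i _ => h0 i) fun i _ =>
      twoPoint_mgf_le_exp_of_le (hp i) (hd0 i) hT (hd1 i)).trans_eq ?_
    rw [Finset.prod_const, Finset.card_univ, Fintype.card_fin, ← Real.exp_nat_mul, mul_comm]

/-- The map `z ↦ (z + v) / (1 + v)` carries the extremal law on `{-v, 1}` to a Bernoulli law with
parameter `v / (1 + v)`, reducing to the binomial optimisation. -/
theorem exp_mul_bennettMGF {t x v : ℝ} (hv : 0 ≤ v) :
    Real.exp (-(t / (1 + v) * x)) * bennettMGF (t / (1 + v)) v =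
      Real.exp (-(t * ((x + v) / (1 + v)))) *
        (1 - v / (1 + v) + v / (1 + v) * Real.exp t) := by
  have h1 : 1 + v ≠ 0 := by positivity
  have e : Real.exp (-(t * ((x + v) / (1 + v)))) =
      Real.exp (-(t / (1 + v) * x)) * Real.exp (-(t / (1 + v) * v)) := by
    rw [← Real.exp_add]
    congr 1
    ring
  rw [bennettMGF, div_mul_cancel₀ t h1, e, mul_div_assoc, mul_assoc]
  congr 2
  field_simp
  ring

theorem le_varianceStrongest {β s l : ℝ} (hβ : 0 < β) (hs : 0 ≤ s) (hl : 0 ≤ l)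
    (h1 : 0 < n → ∀ T : ℝ, 0 ≤ T →
      R ≤ Real.exp (-(T * (l / β))) * bennettMGF T (s / (n * β ^ 2)) ^ n)
    (h2 : ∀ T : ℝ, 0 ≤ T → R ≤ Real.exp (-(T * (l / β))) *
      Real.exp (s / β ^ 2 * (Real.exp T - 1 - T)))
    (h3 : ∀ T : ℝ, 0 ≤ T → R ≤ Real.exp (-(T * (l / β))) * Real.exp (T * n)) :
    R ≤ varianceStrongest n β s l := by
  have key : ∀ t : ℝ, 0 < n → 0 ≤ t → R ≤ (Real.exp (-(t * ((l / (n * β) + s / (n * β ^ 2)) /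
      (1 + s / (n * β ^ 2))))) * (1 - s / (n * β ^ 2) / (1 + s / (n * β ^ 2)) +
        s / (n * β ^ 2) / (1 + s / (n * β ^ 2)) * Real.exp t)) ^ n := by
    intro t hn ht
    have hn' : (0 : ℝ) < n := by exact_mod_cast hn
    have hv : 0 ≤ s / (n * β ^ 2) := by positivity
    rw [← exp_mul_bennettMGF hv]
    refine (h1 hn (t / (1 + s / (n * β ^ 2))) (by positivity)).trans_eq ?_
    rw [mul_pow, ← Real.exp_nat_mul]
    congr 2
    field_simp
  unfold varianceStrongest
  split_ifs with hc1 hc2 hc3 hc4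
  · refine nonpos_of_forall_le_exp_neg (l := l / β - n)
      (sub_pos.2 ((lt_div_iff₀ hβ).2 hc1)) fun t ht => ?_
    refine (h3 t ht).trans_eq ?_
    rw [← Real.exp_add]
    congr 1
    ring
  · rcases Nat.eq_zero_or_pos n with rfl | hn
    · simpa using h3 0 le_rfl
    · have hn' : (0 : ℝ) < n := by exact_mod_cast hn
      have hv : 0 ≤ s / (n * β ^ 2) := by positivity
      have e : s / (n * β ^ 2 + s) = s / (n * β ^ 2) / (1 + s / (n * β ^ 2)) := by
        field_simp
      rw [e]
      refine le_pow_of_forall_exp_mgf_le fun t ht => (key t hn ht).trans_eq ?_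
      rw [hc2, div_self (by positivity), div_self (by positivity), mul_one]
  · simpa using h3 0 le_rfl
  · rw [hc3, zero_div] at h2
    exact le_zero_of_poissonTail (div_pos (lt_of_le_of_ne hl (Ne.symm hc4)) hβ) h2
  · have hlt : l < n * β := lt_of_le_of_ne (not_lt.1 hc1) hc2
    have hn' : (0 : ℝ) < n := pos_of_mul_pos_left (hl.trans_lt hlt) hβ.le
    have hn : 0 < n := by exact_mod_cast hn'
    have hs' : 0 < s := lt_of_le_of_ne hs (Ne.symm hc3)
    obtain ⟨v, hv⟩ : ∃ v, v = s / (n * β ^ 2) := ⟨_, rfl⟩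
    obtain ⟨x, hx⟩ : ∃ x, x = l / (n * β) := ⟨_, rfl⟩
    have hv0 : 0 < v := by rw [hv]; positivity
    have hx0 : 0 ≤ x := by rw [hx]; positivity
    have hx1 : x < 1 := by rw [hx]; exact (div_lt_one (by positivity)).2 hlt
    rw [← hv, ← hx] at key
    have h1v : 0 < 1 + v := by positivity
    have h1x : 0 < 1 - x := by linarith
    refine (le_of_forall_exp_mgf_le (n := n) (p := v / (1 + v)) (q := (x + v) / (1 + v))
      (by positivity) (by gcongr; linarith) ((div_lt_one h1v).2 (by linarith))
      fun t ht => key t hn ht).trans_eq ?_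
    have hu : β * l / s = x / v := by rw [hx, hv]; field_simp
    have hw : s / (n * β ^ 2 + s) = v / (1 + v) := by rw [hv]; field_simp
    have hw' : n * β ^ 2 / (n * β ^ 2 + s) = 1 / (1 + v) := by rw [hv]; field_simp
    have e1 : v / (1 + v) / ((x + v) / (1 + v)) = (1 + x / v)⁻¹ := by field_simp; ring
    have e2 : (1 + x / v) * (v / (1 + v)) = (x + v) / (1 + v) := by field_simp; ring
    have e3 : 1 - (x + v) / (1 + v) = (1 - x) * (1 / (1 + v)) := by field_simp; ring
    have e4 : (1 - v / (1 + v)) / ((1 - x) * (1 / (1 + v))) = (1 - x)⁻¹ := by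
      rw [one_sub_div h1v.ne']
      field_simp
      ring
    rw [hu, ← hx, hw, hw', e2, e3, e4, e1, Real.rpow_neg (by positivity), Real.rpow_neg h1x.le,
      Real.inv_rpow (by positivity), Real.inv_rpow h1x.le]

theorem le_bennettBound {β s l : ℝ} (hβ : 0 < β) (hs : 0 ≤ s) (hl : 0 ≤ l)
    (h : ∀ T : ℝ, 0 ≤ T → R ≤ Real.exp (-(T * (l / β))) *
      Real.exp (s / β ^ 2 * (Real.exp T - 1 - T))) :
    R ≤ bennettBound β s l := by
  unfold bennettBound
  split_ifs with hc1 hc2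
  · exact le_one_of_poissonTail h
  · rw [hc2, zero_div] at h
    exact le_zero_of_poissonTail (div_pos (lt_of_le_of_ne hl (Ne.symm hc1)) hβ) h
  · have hl' : 0 < l := lt_of_le_of_ne hl (Ne.symm hc1)
    have hs' : 0 < s := lt_of_le_of_ne hs (Ne.symm hc2)
    refine (le_exp_neg_bennett (by positivity) (by positivity) h).trans_eq ?_
    have e : l / β / (s / β ^ 2) = β * l / s := by field_simp
    rw [e]
    congr 2
    field_simp
    ring

theorem bennettBound_one_eq {s l : ℝ} : bennettBound 1 s l = bennettBound' s l := by
  unfold bennettBound bennettBound'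
  split_ifs with h1 h2 h2
  · rfl
  · simp [h1]
  · rfl
  · simp only [one_mul, div_one]
    congr 2
    field_simp
    ring

theorem le_bernsteinBound {β s l : ℝ} (hβ : 0 < β) (hs : 0 ≤ s) (hl : 0 ≤ l)
    (h : ∀ T : ℝ, 0 ≤ T → R ≤ Real.exp (-(T * (l / β))) *
      Real.exp (s / β ^ 2 * (Real.exp T - 1 - T))) :
    R ≤ bernsteinBound β s l := by
  refine (le_exp_neg_bernstein (by positivity) (by positivity) h).trans_eq ?_
  unfold bernsteinBound
  split_ifs with hc
  · rcases hl.eq_or_lt with rfl | hl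
    · simp
    · rw [hc]
      congr 2
      field_simp
      norm_num
  · have hs' : 0 < s := lt_of_le_of_ne hs (Ne.symm hc)
    congr 2
    field_simp

theorem le_exp_neg_minSqDiv_of_variance {β s l : ℝ} (hβ : 0 < β) (hs : 0 ≤ s) (hl : 0 ≤ l)
    (h : ∀ T : ℝ, 0 ≤ T → R ≤ Real.exp (-(T * (l / β))) *
      Real.exp (s / β ^ 2 * (Real.exp T - 1 - T))) :
    R ≤ Real.exp (-(1 / 3 * minSqDiv l s (l / β))) := by
  refine (le_exp_neg_minSqDiv (by positivity) (by positivity) h).trans_eq ?_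
  unfold minSqDiv
  congr 3
  split_ifs with h1 h2 h2
  · rfl
  · exact absurd h1 (by positivity)
  · exact absurd (by rw [h2, zero_div]) h1
  · congr 1
    field_simp

end Variance

/-! ### Multiplicative forms -/

section Mult

variable {m δ R : ℝ}

theorem exp_div_rpow_eq (hδ : 0 ≤ δ) :
    (Real.exp δ / (1 + δ) ^ (1 + δ)) ^ m =
      Real.exp (-(((1 + δ) * Real.log (1 + δ) - δ) * m)) := by
  have h1 : 0 < 1 + δ := by positivity
  rw [Real.rpow_def_of_pos h1, ← Real.exp_sub, ← Real.exp_mul]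
  congr 1
  ring

theorem exp_bennett_le_mult (hm : 0 ≤ m) (hδ : 0 ≤ δ) :
    Real.exp (-(((1 + δ) * Real.log (1 + δ) - δ) * m)) ≤
      (Real.exp 1 / (1 + δ)) ^ ((1 + δ) * m) := by
  have h1 : 0 < 1 + δ := by positivity
  rw [Real.rpow_def_of_pos (by positivity), Real.log_div (Real.exp_pos _).ne' h1.ne',
    Real.log_exp]
  exact Real.exp_le_exp.2 (by nlinarith)

theorem exp_bennett_le_mult' (hm : 0 ≤ m) (hδ : 0 ≤ δ) :
    Real.exp (-(((1 + δ) * Real.log (1 + δ) - δ) * m)) ≤ (Real.exp 1 / δ) ^ (δ * m) := by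
  rcases hδ.eq_or_lt with rfl | hδ
  · simp
  rw [Real.rpow_def_of_pos (by positivity), Real.log_div (Real.exp_pos _).ne' hδ.ne',
    Real.log_exp]
  refine Real.exp_le_exp.2 ?_
  have h1 : Real.log δ ≤ Real.log (1 + δ) := Real.log_le_log hδ (by linarith)
  have h2 : 0 ≤ Real.log (1 + δ) := Real.log_nonneg (by linarith)
  have h3 : δ * Real.log δ ≤ (1 + δ) * Real.log (1 + δ) := by nlinarith
  nlinarith [mul_le_mul_of_nonneg_right h3 hm]

theorem exp_bennett_le_exp_bernstein (hm : 0 ≤ m) (hδ : 0 ≤ δ) :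
    Real.exp (-(((1 + δ) * Real.log (1 + δ) - δ) * m)) ≤
      Real.exp (-(δ ^ 2 * m / (2 + 2 / 3 * δ))) := by
  refine Real.exp_le_exp.2 (neg_le_neg ?_)
  rw [mul_div_right_comm]
  exact mul_le_mul_of_nonneg_right (bernstein_le_bennett hδ) hm

theorem exp_bernstein_le_exp_min (hm : 0 ≤ m) (hδ : 0 ≤ δ) :
    Real.exp (-(δ ^ 2 * m / (2 + 2 / 3 * δ))) ≤ Real.exp (-(min (δ ^ 2) δ * m / 3)) := by
  refine Real.exp_le_exp.2 (neg_le_neg ?_)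
  rw [mul_div_right_comm, mul_div_right_comm]
  exact mul_le_mul_of_nonneg_right (min_div_three_le_bernstein hδ) hm

theorem le_two_rpow_neg {k : ℝ} (hm : 0 ≤ m) (hk : 2 * Real.exp 1 * m ≤ k)
    (h : ∀ t : ℝ, 0 ≤ t → R ≤ Real.exp (-(t * k)) * Real.exp (m * (Real.exp t - 1))) :
    R ≤ (2 : ℝ) ^ (-k) := by
  have he := Real.add_one_le_exp (1 : ℝ)
  -- With `exp t = 2e` the exponent is `-k log 2 - k + (2e - 1)m`, and `(2e - 1)m ≤ k`.
  refine (h (Real.log (2 * Real.exp 1)) (Real.log_nonneg (by linarith))).trans ?_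
  rw [← Real.exp_add, Real.exp_log (by positivity), Real.rpow_def_of_pos two_pos,
    Real.log_mul two_ne_zero (Real.exp_pos _).ne', Real.log_exp]
  exact Real.exp_le_exp.2 (by nlinarith)

end Mult

/-! ### Assembly of all bounds -/

theorem mainTheorem1 {Ω : Type*} [MeasurableSpace Ω] (P : Measure Ω) [IsProbabilityMeasure P]
    (n : ℕ) (X : Fin n → Ω → ℝ) (hX : IsBinaryFamily P X) (hneg : OneNegativelyCorrelated P X)
    (a b : Fin n → ℝ) (hab : ∀ i, a i ≤ b i)
    (Y : Fin n → Ω → ℝ)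
    (hY : ∀ i, ∀ᵐ ω ∂P, (X i ω = 0 → Y i ω = a i) ∧ (X i ω = 1 → Y i ω = b i))
    (S : Ω → ℝ) (hS : ∀ ω, S ω = ∑ i, Y i ω)
    (s : ℝ) (hs : s = ∑ i, variance (Y i) P)
    -- `m` is the expectation of `S` or any upper bound for it
    (m : ℝ) (hm : ∫ ω, S ω ∂P ≤ m) :
    -- values in `[0,1]`
    ((∀ i, a i ∈ Set.Icc (0 : ℝ) 1 ∧ b i ∈ Set.Icc (0 : ℝ) 1) →
      -- multiplicative bounds
      (∀ δ : ℝ, 0 ≤ δ →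
        P.real {ω | (1 + δ) * m ≤ S ω} ≤ chernoffMult n m δ ∧
        P.real {ω | (1 + δ) * m ≤ S ω} ≤ (Real.exp δ / (1 + δ) ^ (1 + δ)) ^ m ∧
        P.real {ω | (1 + δ) * m ≤ S ω} ≤
          Real.exp (-(((1 + δ) * Real.log (1 + δ) - δ) * m)) ∧
        P.real {ω | (1 + δ) * m ≤ S ω} ≤ Real.exp (-(δ ^ 2 * m / (2 + 2 / 3 * δ))) ∧
        P.real {ω | (1 + δ) * m ≤ S ω} ≤ Real.exp (-(min (δ ^ 2) δ * m / 3)) ∧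
        (δ ≤ 1 → P.real {ω | (1 + δ) * m ≤ S ω} ≤ Real.exp (-(δ ^ 2 * m / 3))) ∧
        P.real {ω | (1 + δ) * m ≤ S ω} ≤ (Real.exp 1 / (1 + δ)) ^ ((1 + δ) * m) ∧
        P.real {ω | (1 + δ) * m ≤ S ω} ≤ (Real.exp 1 / δ) ^ (δ * m)) ∧
      (∀ k : ℝ, 2 * Real.exp 1 * m ≤ k → P.real {ω | k ≤ S ω} ≤ (2 : ℝ) ^ (-k)) ∧
      -- additive bounds
      (∀ l : ℝ, 0 ≤ l →
        P.real {ω | m + l ≤ S ω} ≤ Real.exp (-(2 * l ^ 2 / n)) ∧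
        P.real {ω | m + l ≤ S ω} ≤ chernoffAdd n m l ∧
        P.real {ω | m + l ≤ S ω} ≤ Real.exp l * (m / (m + l)) ^ (m + l) ∧
        P.real {ω | m + l ≤ S ω} ≤ chernoffAddExp m l ∧
        P.real {ω | m + l ≤ S ω} ≤ Real.exp (-(l ^ 2 / (2 * m + 2 / 3 * l))) ∧
        P.real {ω | m + l ≤ S ω} ≤ Real.exp (-(1 / 3 * minSqDiv l m l)) ∧
        (l ≤ m → P.real {ω | m + l ≤ S ω} ≤ Real.exp (-(l ^ 2 / (3 * m))))) ∧
      -- bounds using the variance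
      (∀ l : ℝ, 0 ≤ l →
        P.real {ω | m + l ≤ S ω} ≤ varianceStrongest n 1 s l ∧
        P.real {ω | m + l ≤ S ω} ≤ bennettBound 1 s l ∧
        P.real {ω | m + l ≤ S ω} ≤ bennettBound' s l ∧
        P.real {ω | m + l ≤ S ω} ≤ Real.exp (-(l ^ 2 / (2 * s + 2 / 3 * l))) ∧
        P.real {ω | m + l ≤ S ω} ≤ Real.exp (-(1 / 3 * minSqDiv l s l))) ∧
      -- bounds using the variance, multiplicative form
      (∀ δ : ℝ, 0 ≤ δ →
        P.real {ω | (1 + δ) * m ≤ S ω} ≤ varianceStrongest n 1 s (δ * m) ∧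
        P.real {ω | (1 + δ) * m ≤ S ω} ≤
          Real.exp (-(δ ^ 2 * m ^ 2 / (2 * s + 2 / 3 * (δ * m)))))) ∧
    -- arbitrary real values: additive bound with individual ranges
    (∀ l : ℝ, 0 < l →
      P.real {ω | m + l ≤ S ω} ≤ hoeffdingBound (∑ i, (b i - a i) ^ 2) l) ∧
    -- arbitrary real values: bounds using the variance
    (∀ β : ℝ, 0 < β → (∀ i, ∀ᵐ ω ∂P, Y i ω ≤ (∫ ω', Y i ω' ∂P) + β) →
      ∀ l : ℝ, 0 ≤ l →
        P.real {ω | m + l ≤ S ω} ≤ varianceStrongest n β s l ∧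
        P.real {ω | m + l ≤ S ω} ≤ bennettBound β s l ∧
        P.real {ω | m + l ≤ S ω} ≤ bernsteinBound β s l ∧
        P.real {ω | m + l ≤ S ω} ≤ Real.exp (-(1 / 3 * minSqDiv l s (l / β)))) := by
  have hp : ∀ i, P.real {ω | X i ω = 1} ∈ Set.Icc (0 : ℝ) 1 := fun i =>
    ⟨measureReal_nonneg, measureReal_le_one⟩
  have hEY : ∀ i, ∫ ω, Y i ω ∂P =
      (1 - P.real {ω | X i ω = 1}) * a i + P.real {ω | X i ω = 1} * b i := fun i =>
    integral_comp_of_twoValued (hX i).1 (hX i).2 (hY i) fun y => y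
  have hES : ∑ i, ((1 - P.real {ω | X i ω = 1}) * a i + P.real {ω | X i ω = 1} * b i) ≤ m := by
    refine le_trans (le_of_eq ?_) hm
    simp only [hS]
    rw [integral_finsetSum _ fun i _ =>
      integrable_comp_of_twoValued (hX i).1 (hX i).2 (hY i) fun y => y]
    exact Finset.sum_congr rfl fun i _ => (hEY i).symm
  have hs' : s = ∑ i, (b i - a i) ^ 2 * P.real {ω | X i ω = 1} * (1 - P.real {ω | X i ω = 1}) := by
    rw [hs]
    exact Finset.sum_congr rfl fun i _ => variance_of_twoValued (hX i).1 (hX i).2 (hY i)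
  have hs0 : 0 ≤ s := by
    rw [hs]
    exact Finset.sum_nonneg fun i _ => variance_nonneg _ _
  have tail := fun x t ht => tail_le_of_oneNegativelyCorrelated hX hneg hab hY hS x (t := t) ht
  -- Hoeffding's bound
  have hoeff : ∀ l : ℝ, 0 < l →
      P.real {ω | m + l ≤ S ω} ≤ hoeffdingBound (∑ i, (b i - a i) ^ 2) l := by
    intro l hl
    have h : ∀ t : ℝ, 0 ≤ t → P.real {ω | m + l ≤ S ω} ≤
        Real.exp (-(t * l) + (∑ i, (b i - a i) ^ 2) * t ^ 2 / 8) := by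
      intro t ht
      refine (tail (m + l) t ht).trans ((mul_le_mul_of_nonneg_left (Finset.prod_le_prod
        (fun i _ => add_nonneg (mul_nonneg (sub_nonneg.2 (hp i).2) (Real.exp_pos _).le)
          (mul_nonneg (hp i).1 (Real.exp_pos _).le))
        fun i _ => twoPoint_mgf_le_hoeffding (hab i) (hX i).1 (hX i).2 (hY i) t)
        (Real.exp_pos _).le).trans ?_)
      rw [Finset.prod_mul_distrib, ← Real.exp_sum, ← Real.exp_sum, ← Real.exp_add, ← Real.exp_add,
        ← Finset.mul_sum, ← Finset.sum_div, ← Finset.sum_mul]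
      simp only [hEY]
      exact Real.exp_le_exp.2 (by nlinarith [mul_le_mul_of_nonneg_left hES ht])
    unfold hoeffdingBound
    split_ifs with hC
    · refine nonpos_of_forall_le_exp_neg hl fun t ht => ?_
      simpa [hC] using h t ht
    · have hC' : 0 < ∑ i, (b i - a i) ^ 2 :=
        lt_of_le_of_ne (Finset.sum_nonneg fun i _ => sq_nonneg _) (Ne.symm hC)
      -- The minimiser of `-tl + Ct²/8`, with `C` the sum of squared ranges.
      refine (h (4 * l / ∑ i, (b i - a i) ^ 2) (by positivity)).trans_eq ?_
      congr 1
      field_simp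
      ring
  -- bounds from the variance
  have hvar : ∀ β : ℝ, 0 < β → (∀ i, ∀ᵐ ω ∂P, Y i ω ≤ (∫ ω', Y i ω' ∂P) + β) →
      ∀ l : ℝ, (0 < n → ∀ T : ℝ, 0 ≤ T → P.real {ω | m + l ≤ S ω} ≤
          Real.exp (-(T * (l / β))) * bennettMGF T (s / (n * β ^ 2)) ^ n) ∧
        (∀ T : ℝ, 0 ≤ T → P.real {ω | m + l ≤ S ω} ≤
          Real.exp (-(T * (l / β))) * Real.exp (s / β ^ 2 * (Real.exp T - 1 - T))) ∧
        (∀ T : ℝ, 0 ≤ T → P.real {ω | m + l ≤ S ω} ≤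
          Real.exp (-(T * (l / β))) * Real.exp (T * n)) := by
    intro β hβ hYβ l
    have hle : ∀ i, P.real {ω | X i ω = 1} = 0 ∨
        (b i - a i) * (1 - P.real {ω | X i ω = 1}) ≤ β := fun i =>
      (prob_eq_zero_or_le_of_ae_le (hY i) (hYβ i)).imp id fun h => by
        rw [hEY] at h
        linarith
    have h : ∀ T : ℝ, 0 ≤ T → ∃ Q : ℝ,
        P.real {ω | m + l ≤ S ω} ≤ Real.exp (-(T * (l / β))) * Q ∧
        (0 < n → Q ≤ bennettMGF T (s / (n * β ^ 2)) ^ n) ∧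
        Q ≤ Real.exp (s / β ^ 2 * (Real.exp T - 1 - T)) ∧ Q ≤ Real.exp (T * n) := by
      intro T hT
      obtain ⟨Q, hQ, hQ'⟩ := prod_twoPoint_le_of_variance hβ hp hab hle hs' hT
      have ht := tail (m + l) (T / β) (by positivity)
      rw [hQ, ← mul_assoc, ← Real.exp_add] at ht
      refine ⟨Q, ht.trans (mul_le_mul_of_nonneg_right (Real.exp_le_exp.2 ?_) ?_), hQ'⟩
      · have := mul_le_mul_of_nonneg_left hES (div_nonneg hT hβ.le)
        have e : T * (l / β) = T / β * l := by ring
        rw [e]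
        linarith
      · exact nonneg_of_mul_nonneg_right (measureReal_nonneg.trans ht) (Real.exp_pos _)
    refine ⟨fun hn T hT => ?_, fun T hT => ?_, fun T hT => ?_⟩ <;> obtain ⟨Q, h1, h2, h3, h4⟩ := h T hT
    · exact h1.trans (mul_le_mul_of_nonneg_left (h2 hn) (Real.exp_pos _).le)
    · exact h1.trans (mul_le_mul_of_nonneg_left h3 (Real.exp_pos _).le)
    · exact h1.trans (mul_le_mul_of_nonneg_left h4 (Real.exp_pos _).le)
  refine ⟨fun hunit => ?_, hoeff, fun β hβ hYβ l hl => ?_⟩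
  swap
  · obtain ⟨h1, h2, h3⟩ := hvar β hβ hYβ l
    exact ⟨le_varianceStrongest hβ hs0 hl h1 h2 h3, le_bennettBound hβ hs0 hl h2,
      le_bernsteinBound hβ hs0 hl h2, le_exp_neg_minSqDiv_of_variance hβ hs0 hl h2⟩
  -- values in `[0,1]`
  have hmean0 : ∀ i, 0 ≤ (1 - P.real {ω | X i ω = 1}) * a i + P.real {ω | X i ω = 1} * b i :=
    fun i => add_nonneg (mul_nonneg (sub_nonneg.2 (hp i).2) (hunit i).1.1)
      (mul_nonneg (hp i).1 (hunit i).2.1)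
  have hm0 : 0 ≤ m := (Finset.sum_nonneg fun i _ => hmean0 i).trans hES
  have hprod := fun t ht => prod_twoPoint_le_of_mean hp (fun i => (hunit i).1)
    (fun i => (hunit i).2) hES (t := t) ht
  have mean1 : ∀ x t : ℝ, 0 ≤ t → P.real {ω | x ≤ S ω} ≤
      Real.exp (-(t * x)) * Real.exp (m * (Real.exp t - 1)) := fun x t ht =>
    (tail x t ht).trans (mul_le_mul_of_nonneg_left (hprod t ht).1 (Real.exp_pos _).le)
  have mean1' : ∀ l t : ℝ, 0 ≤ t → P.real {ω | m + l ≤ S ω} ≤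
      Real.exp (-(t * l)) * Real.exp (m * (Real.exp t - 1 - t)) := fun l t ht => by
    refine (mean1 (m + l) t ht).trans_eq ?_
    rw [← Real.exp_add, ← Real.exp_add]
    congr 1
    ring
  have hadd : ∀ l : ℝ, 0 ≤ l → P.real {ω | m + l ≤ S ω} ≤ chernoffAdd n m l := fun l hl =>
    le_chernoffAdd hm0 hl
      (fun hn t ht => (tail _ t ht).trans
        (mul_le_mul_of_nonneg_left ((hprod t ht).2.1 hn) (Real.exp_pos _).le))
      fun t ht => (tail _ t ht).trans
        (mul_le_mul_of_nonneg_left (hprod t ht).2.2 (Real.exp_pos _).le)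
  -- For values in `[0,1]`, `β = 1` is admissible: `Y i ≤ 1` and the mean is nonnegative.
  have hvar1 := hvar 1 one_pos fun i => by
    filter_upwards [(hX i).2, hY i] with ω h1 h2
    have h0 := hmean0 i
    rw [← hEY] at h0
    rcases h1 with h | h
    · rw [h2.1 h]
      linarith [(hunit i).1.2]
    · rw [h2.2 h]
      linarith [(hunit i).2.2]
  have hbern : ∀ l : ℝ, 0 ≤ l → P.real {ω | m + l ≤ S ω} ≤
      Real.exp (-(l ^ 2 / (2 * s + 2 / 3 * l))) := fun l hl =>
    le_exp_neg_bernstein hs0 hl (by simpa using (hvar1 l).2.1)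
  have hstrong : ∀ l : ℝ, 0 ≤ l → P.real {ω | m + l ≤ S ω} ≤ varianceStrongest n 1 s l :=
    fun l hl => le_varianceStrongest one_pos hs0 hl (hvar1 l).1 (hvar1 l).2.1 (hvar1 l).2.2
  have hmul : ∀ δ : ℝ, (1 + δ) * m = m + δ * m := fun δ => by ring
  have hone : ∀ x, P.real {ω | x ≤ S ω} ≤ 1 := fun x => measureReal_le_one
  refine ⟨fun δ hδ => ?_, fun k hk => le_two_rpow_neg hm0 hk (mean1 k), fun l hl => ?_,
    fun l hl => ?_, fun δ hδ => ?_⟩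
  · have h3 : P.real {ω | (1 + δ) * m ≤ S ω} ≤
        Real.exp (-(((1 + δ) * Real.log (1 + δ) - δ) * m)) := by
      rcases hm0.eq_or_lt with h0 | h0
      · rw [← h0]
        simp
      · rw [hmul]
        refine (le_exp_neg_bennett h0 (by positivity) (mean1' (δ * m))).trans_eq ?_
        rw [mul_div_cancel_right₀ _ h0.ne', mul_comm m]
    have h4 := h3.trans (exp_bennett_le_exp_bernstein hm0 hδ)
    have h5 := h4.trans (exp_bernstein_le_exp_min hm0 hδ)
    refine ⟨?_, h3.trans_eq (exp_div_rpow_eq hδ).symm, h3, h4, h5, fun hδ1 => ?_,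
      h3.trans (exp_bennett_le_mult hm0 hδ), h3.trans (exp_bennett_le_mult' hm0 hδ)⟩
    · rcases hm0.eq_or_lt with h0 | h0
      · refine (hone _).trans_eq ?_
        rw [← h0]
        unfold chernoffMult
        rcases Nat.eq_zero_or_pos n with rfl | hn
        · simp
        · have hn' : (n : ℝ) ≠ 0 := by positivity
          simp [hn', hn'.symm]
      · rw [chernoffMult_eq_chernoffAdd h0, hmul]
        exact hadd _ (by positivity)
    · rwa [min_eq_left (by nlinarith)] at h5
  · have h4 := le_chernoffAddExp hm0 hl (mean1' l)
    have h6 := le_exp_neg_minSqDiv hm0 hl (mean1' l)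
    refine ⟨?_, hadd l hl, h4.trans_eq (chernoffAddExp_eq hm0 hl), h4,
      le_exp_neg_bernstein hm0 hl (mean1' l), h6, fun hlm => ?_⟩
    -- `l = 0` is split off because `hoeff` needs `l > 0`: with all ranges zero, `hoeffdingBound` is
    -- `0`.
    · rcases hl.eq_or_lt with rfl | hl
      · simp
      · refine (hoeff l hl).trans ?_
        unfold hoeffdingBound
        split_ifs with hC
        · exact (Real.exp_pos _).le
        · have hC' : 0 < ∑ i, (b i - a i) ^ 2 :=
            lt_of_le_of_ne (Finset.sum_nonneg fun i _ => sq_nonneg _) (Ne.symm hC)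
          have hCn : ∑ i, (b i - a i) ^ 2 ≤ n := by
            refine (Finset.sum_le_card_nsmul _ _ 1 fun i _ => ?_).trans_eq (by simp)
            have := hab i
            have := (hunit i).1.1
            have := (hunit i).2.2
            nlinarith
          exact Real.exp_le_exp.2 (neg_le_neg
            (div_le_div_of_nonneg_left (by positivity) hC' hCn))
    · unfold minSqDiv at h6
      split_ifs at h6 with h0
      · rw [h0]
        simp
      · have hm' : 0 < m := lt_of_le_of_ne hm0 (Ne.symm h0)
        rw [min_eq_left ((div_le_iff₀ hm').2 (by nlinarith))] at h6
        refine h6.trans_eq ?_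
        congr 2
        field_simp
  · have h2 := le_bennettBound one_pos hs0 hl (hvar1 l).2.1
    refine ⟨hstrong l hl, h2, h2.trans_eq bennettBound_one_eq, hbern l hl, ?_⟩
    simpa using le_exp_neg_minSqDiv_of_variance one_pos hs0 hl (hvar1 l).2.1
  · rw [hmul, ← mul_pow]
    exact ⟨hstrong _ (by positivity), hbern _ (by positivity)⟩
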